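/- Let $k$ be a field. A Hopf brace over $k$ is a $k$-coalgebra $(H,\Delta,\varepsilon)$ with two Hopf algebra structures $H_\bullet=(H,\cdot,1,\Delta,\varepsilon,S)$ and $H_\diamond=(H,\diamond,1_\diamond,\Delta,\varepsilon,T)$ such that, in Sweedler notation, $$x\diamond(y\cdot z)=(x_{(1)}\diamond y)\cdot S(x_{(2)})\cdot(x_{(3)}\diamond z)\qquad\text{for all }x,y,z\in H.$$ A morphism of Hopf braces is a $k$-linear map that is a morphism of Hopf algebras for both the first structures $H_\bullet$ and the second structures $H_\diamond$. A Hopf brace is cocommutative if its underlying coalgebra is. Let $\mathrm{Hbr}^{coc}$ be the category of cocommutative Hopf braces over $k$ and $\mathrm{Halg}^{coc}$ the category of cocommutative Hopf algebras over $k$. Then both forgetful functors $U_\bullet,U_\diamond\colon \mathrm{Hbr}^{coc}\to \mathrm{Halg}^{coc}$, $U_\bullet(H)=H_\bullet$ and $U_\diamond(H)=H_\diamond$, have left adjoints. In particular, let $U$ be either of these functors. For every cocommutative Hopf algebra $H$ there are a cocommutative Hopf brace $B$ and a morphism of Hopf algebras $\eta\colon H\to U(B)$ such that for every cocommutative Hopf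 brace $B'$ and every morphism of Hopf algebras $f\colon H\to U(B')$ there is a unique morphism of Hopf braces $g\colon B\to B'$ with $U(g)\circ\eta=f$. -/

import Mathlib

open CategoryTheory Coalgebra
open scoped TensorProduct

universe u

/-- A Hopf algebra structure on a given `k`-coalgebra `(V, Δ, ε)`: a unital associative
multiplication, compatible with `Δ` and `ε`, together with an antipode. -/
structure HopfStructure (k V : Type u) [Field k] [AddCommGroup V] [Module k V]
    [Coalgebra k V] where
  mul : V →ₗ[k] V →ₗ[k] V
  one : V
  antipode : V →ₗ[k] V
  mul_assoc : ∀ x y z, mul (mul x y) z = mul x (mul y z)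
  one_mul : ∀ x, mul one x = x
  mul_one : ∀ x, mul x one = x
  counit_one : counit (R := k) one = 1
  counit_mul : ∀ x y, counit (R := k) (mul x y) = counit (R := k) x * counit (R := k) y
  comul_one : comul (R := k) one = one ⊗ₜ[k] one
  comul_mul : ∀ x y,
    comul (R := k) (mul x y) = TensorProduct.map₂ mul mul (comul (R := k) x) (comul (R := k) y)
  /-- `S(x₁) x₂ = ε(x) 1` -/
  antipode_left : ∀ x,
    TensorProduct.lift mul (antipode.rTensor V (comul (R := k) x)) = counit (R := k) x • one
  /-- `x₁ S(x₂) = ε(x) 1` -/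
  antipode_right : ∀ x,
    TensorProduct.lift mul (antipode.lTensor V (comul (R := k) x)) = counit (R := k) x • one

namespace HopfStructure

variable {k V : Type u} [Field k] [AddCommGroup V] [Module k V] [Coalgebra k V]

/-- The underlying space of the Hopf algebra given by a Hopf algebra structure on `V`. It is `V`
itself, and the multiplication is that of the structure. -/
def Carrier (_s : HopfStructure k V) : Type u := V

instance (s : HopfStructure k V) : Ring s.Carrier where
  __ := (inferInstance : AddCommGroup V)
  mul x y := s.mul x y
  one := s.one
  mul_assoc := s.mul_assoc
  one_mul := s.one_mul
  mul_one := s.mul_one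
  left_distrib x y z := (s.mul x).map_add y z
  right_distrib x y z := LinearMap.map_add₂ s.mul x y z
  zero_mul x := LinearMap.map_zero₂ s.mul x
  mul_zero x := (s.mul x).map_zero

instance (s : HopfStructure k V) : Module k s.Carrier := inferInstanceAs (Module k V)

instance (s : HopfStructure k V) : Coalgebra k s.Carrier := inferInstanceAs (Coalgebra k V)

instance (s : HopfStructure k V) : Algebra k s.Carrier :=
  Algebra.ofModule (fun r x y => LinearMap.map_smul₂ s.mul r x y)
    (fun r x y => (s.mul x).map_smul r y)

theorem tensor_mul_def (s : HopfStructure k V) (a b : s.Carrier ⊗[k] s.Carrier) :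
    a * b = TensorProduct.map₂ (LinearMap.mul k s.Carrier) (LinearMap.mul k s.Carrier) a b := by
  induction a using TensorProduct.induction_on with
  | zero => simp
  | add a a' h h' => simp [add_mul, h, h']
  | tmul x y =>
    induction b using TensorProduct.induction_on with
    | zero => simp
    | add b b' h h' => simp [mul_add, h, h']
    | tmul z w => simp

noncomputable instance (s : HopfStructure k V) : HopfAlgebra k s.Carrier where
  __ := Bialgebra.mk' k s.Carrier s.counit_one (fun {a b} => s.counit_mul a b) s.comul_one
    (fun {a b} => (s.comul_mul a b).trans (s.tensor_mul_def _ _).symm)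
  antipode := s.antipode
  mul_antipode_rTensor_comul := by
    ext x
    exact (s.antipode_left x).trans (Algebra.algebraMap_eq_smul_one (A := s.Carrier) _).symm
  mul_antipode_lTensor_comul := by
    ext x
    exact (s.antipode_right x).trans (Algebra.algebraMap_eq_smul_one (A := s.Carrier) _).symm

end HopfStructure

/-- A Hopf brace over a coalgebra `V`: two Hopf algebra structures `(·, 1, S)` and
`(⋄, 1⋄, T)` on the coalgebra `V` such that
`x ⋄ (y · z) = ((x₁ ⋄ y) · S(x₂)) · (x₃ ⋄ z)`. -/
structure HopfBrace (k V : Type u) [Field k] [AddCommGroup V] [Module k V]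
    [Coalgebra k V] where
  /-- The first Hopf algebra structure `(·, 1, S)`. -/
  fst : HopfStructure k V
  /-- The second Hopf algebra structure `(⋄, 1⋄, T)`. -/
  snd : HopfStructure k V
  compat : ∀ x y z : V,
    snd.mul x (fst.mul y z) =
      TensorProduct.lift fst.mul
        (TensorProduct.map
          (TensorProduct.lift fst.mul ∘ₗ TensorProduct.map (snd.mul.flip y) fst.antipode)
          (snd.mul.flip z)
          ((comul (R := k) (A := V)).rTensor V (comul (R := k) x)))

/-- The objects of the category of Hopf braces over `k`. -/
structure HopfBraceCat (k : Type u) [Field k] where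
  carrier : Type u
  [addCommGroup : AddCommGroup carrier]
  [module : Module k carrier]
  [coalgebra : Coalgebra k carrier]
  brace : HopfBrace k carrier

namespace HopfBraceCat

attribute [instance] addCommGroup module coalgebra

variable {k : Type u} [Field k]

/-- A morphism of Hopf braces: a `k`-linear map that is a morphism of Hopf algebras (that is, a
map of coalgebras and of unital algebras) for the first and for the second structures. -/
@[ext]
structure Hom (A B : HopfBraceCat k) where
  toCoalgHom : A.carrier →ₗc[k] B.carrier
  map_fst_one : toCoalgHom A.brace.fst.one = B.brace.fst.one
  map_fst_mul : ∀ x y, toCoalgHom (A.brace.fst.mul x y) =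
    B.brace.fst.mul (toCoalgHom x) (toCoalgHom y)
  map_snd_one : toCoalgHom A.brace.snd.one = B.brace.snd.one
  map_snd_mul : ∀ x y, toCoalgHom (A.brace.snd.mul x y) =
    B.brace.snd.mul (toCoalgHom x) (toCoalgHom y)

instance : Category (HopfBraceCat k) where
  Hom := Hom
  id A := ⟨CoalgHom.id k A.carrier, rfl, fun _ _ => rfl, rfl, fun _ _ => rfl⟩
  comp {A B C} f g :=
    { toCoalgHom := g.toCoalgHom.comp f.toCoalgHom
      map_fst_one := by simp [f.map_fst_one, g.map_fst_one]
      map_fst_mul := fun x y => by simp [f.map_fst_mul, g.map_fst_mul]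
      map_snd_one := by simp [f.map_snd_one, g.map_snd_one]
      map_snd_mul := fun x y => by simp [f.map_snd_mul, g.map_snd_mul] }

variable (k)

/-- The functor from Hopf braces to Hopf algebras that remembers the first Hopf algebra
structure. -/
noncomputable def forgetFst : HopfBraceCat k ⥤ HopfAlgCat.{u} k where
  obj A := HopfAlgCat.of k A.brace.fst.Carrier
  map {A B} f := HopfAlgCat.ofHom
    { toCoalgHom := f.toCoalgHom
      map_one' := f.map_fst_one
      map_mul' := f.map_fst_mul }

/-- The functor from Hopf braces to Hopf algebras that remembers the second Hopf algebra
structure. -/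
noncomputable def forgetSnd : HopfBraceCat k ⥤ HopfAlgCat.{u} k where
  obj A := HopfAlgCat.of k A.brace.snd.Carrier
  map {A B} f := HopfAlgCat.ofHom
    { toCoalgHom := f.toCoalgHom
      map_one' := f.map_snd_one
      map_mul' := f.map_snd_mul }

end HopfBraceCat

/-- The property of a Hopf algebra of being cocommutative. -/
def HopfAlgCat.isCocomm (k : Type u) [Field k] : ObjectProperty (HopfAlgCat.{u} k) :=
  fun H => IsCocomm k H

/-- The property of a Hopf brace that its underlying coalgebra is cocommutative. -/
def HopfBraceCat.isCocomm (k : Type u) [Field k] : ObjectProperty (HopfBraceCat k) :=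
  fun A => IsCocomm k A.carrier

/-- The category of cocommutative Hopf algebras over `k`. -/
abbrev CocommHopfAlgCat (k : Type u) [Field k] := (HopfAlgCat.isCocomm k).FullSubcategory

/-- The category of cocommutative Hopf braces over `k`. -/
abbrev CocommHopfBraceCat (k : Type u) [Field k] := (HopfBraceCat.isCocomm k).FullSubcategory

namespace CocommHopfBraceCat

variable (k : Type u) [Field k]

/-- The functor from cocommutative Hopf braces to cocommutative Hopf algebras that remembers the
first Hopf algebra structure. -/
noncomputable def forgetFst : CocommHopfBraceCat k ⥤ CocommHopfAlgCat k :=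
  (HopfAlgCat.isCocomm k).lift
    ((HopfBraceCat.isCocomm k).ι ⋙ HopfBraceCat.forgetFst k) (fun A => A.property)

/-- The functor from cocommutative Hopf braces to cocommutative Hopf algebras that remembers the
second Hopf algebra structure. -/
noncomputable def forgetSnd : CocommHopfBraceCat k ⥤ CocommHopfAlgCat k :=
  (HopfAlgCat.isCocomm k).lift
    ((HopfBraceCat.isCocomm k).ι ⋙ HopfBraceCat.forgetSnd k) (fun A => A.property)

end CocommHopfBraceCat

/-! The left adjoints are built as in universal algebra: formal expressions modulo identities.
Starting from a cocommutative Hopf algebra `H`, let `F` be the vector space freely generated by `H`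
under two products, two constants and two unary operations (`FreeOps`). The coalgebra structure of
`H` extends to `F` in exactly one way that makes all operations coalgebra morphisms, and
cocommutativity is inherited. Divide `F` by the smallest subspace `I` that is closed under the
operations and contains the defects of the Hopf brace axioms and of the multiplicativity of `H → F`
for the chosen structure.

The crux is that `I` is a coideal (`counit_eq_zero_and_map_proj_comul_eq_zero`). On a cocommutative
coalgebra `Δ` is a coalgebra morphism, so convolutions of coalgebra morphisms are coalgebra
morphisms. Hence both sides of every axiom, even those that repeat a variable through `Δ`, are
coalgebra morphisms `L`, `R` in their arguments. If `L` and `R` agree modulo `I`, then `Δ(L d - R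
d)` dies in the tensor square of the quotient (`coideal_of_coalgHom`).

For the universal property, expressions are evaluated in a cocommutative Hopf brace. Evaluation is a
coalgebra morphism because the antipode of a cocommutative Hopf algebra is one (`comul_antipode`),
and it kills `I`. Uniqueness holds because bialgebra morphisms preserve antipodes (`map_antipode`),
so a morphism is determined on every expression by its values on `H`. A Boolean `c₀` handles both
forgetful functors at once. -/

namespace HopfAlgebra

/-! ### Antipodes and convolution inverses. -/

open WithConv LinearMap

/-- Both composites are convolution inverses of `g`, one from the left and one from the right, so
they coincide. -/
theorem map_antipode {R A B : Type*} [CommRing R] [Ring A] [Ring B] [HopfAlgebra R A]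
    [HopfAlgebra R B] (g : A →ₐc[R] B) (x : A) : g (antipode R x) = antipode R (g x) := by
  have h : toConv ((g : A →ₐ[R] B).toLinearMap ∘ₗ antipode R) =
      toConv (antipode R ∘ₗ (g : A →ₗc[R] B).toLinearMap) := by
    apply left_inv_eq_right_inv (a := toConv (g : A →ₐ[R] B).toLinearMap)
    · have := algHom_comp_convMul_distrib (g : A →ₐ[R] B) (toConv (antipode R))
        (toConv LinearMap.id)
      rw [antipode_mul_id] at this
      apply ofConv_injective
      refine Eq.trans this.symm ?_
      ext y
      exact (g : A →ₐ[R] B).commutes _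
    · have := convMul_comp_coalgHom_distrib (toConv LinearMap.id) (toConv (antipode R (A := B)))
        (g : A →ₗc[R] B)
      rw [id_mul_antipode] at this
      apply ofConv_injective
      refine Eq.trans this.symm ?_
      ext y
      simp [LinearMap.convOne_def]
  exact congr($(h).ofConv x)

/-- Both sides are convolution inverses of `Δ`. Cocommutativity makes `Δ` a coalgebra morphism, so
that `((S ⊗ S) ∘ Δ) * Δ = ((S * id) ⊗ (S * id)) ∘ Δ`. -/
theorem comul_antipode {R A : Type*} [CommRing R] [Ring A] [HopfAlgebra R A] [IsCocomm R A]
    (x : A) :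
    comul (R := R) (antipode R x) =
      TensorProduct.map (antipode R) (antipode R) (comul (R := R) x) := by
  have h : toConv (TensorProduct.map (antipode R) (antipode R) ∘ₗ
        (comulCoalgHom R A).toLinearMap) =
      toConv (comul (R := R) ∘ₗ antipode R (A := A)) := by
    apply left_inv_eq_right_inv (a := toConv (comul (R := R) (A := A)))
    · have := convMul_comp_coalgHom_distrib
        (toConv (TensorProduct.map (antipode R) (antipode R) : A ⊗[R] A →ₗ[R] A ⊗[R] A))
        (toConv (TensorProduct.map LinearMap.id LinearMap.id))
        (comulCoalgHom R A)
      rw [TensorProduct.map_convMul_map (f := toConv (antipode R (A := A)))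
        (g := toConv (antipode R (A := A))) (h := toConv LinearMap.id) (k := toConv LinearMap.id),
        antipode_mul_id] at this
      apply ofConv_injective
      refine Eq.trans ?_ (this.symm.trans ?_)
      · rw [TensorProduct.map_id]
        rfl
      · ext y
        have h2 := (CoalgHomClass.counit_comp_apply (comulCoalgHom R A) y)
        have key : ∀ t : A ⊗[R] A,
            TensorProduct.map (1 : WithConv (A →ₗ[R] A)).ofConv (1 : WithConv (A →ₗ[R] A)).ofConv t
              = algebraMap R (A ⊗[R] A) (counit t) := by
          intro t
          induction t using TensorProduct.induction_on with
          | zero => simp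
          | add a b ha hb => simp only [map_add, ha, hb]
          | tmul a b =>
            simp [LinearMap.convOne_def, Algebra.algebraMap_eq_smul_one, Algebra.TensorProduct.one_def,
              TensorProduct.smul_tmul', smul_smul, mul_comm]
        exact (key _).trans (congrArg _ h2)
    · exact comul_right_inv
  exact congr($(h).ofConv x).symm

end HopfAlgebra

/-! ### Operations on coalgebras, and both sides of the brace identity as coalgebra morphisms. -/

/-- A family of operations on a coalgebra `V`, indexed by `Bool`: binary operations, constants
and unary operations, each of them a morphism of coalgebras. No identities are imposed. -/
structure CoalgOps (k V : Type u) [Field k] [AddCommGroup V] [Module k V] [Coalgebra k V] where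
  mul : Bool → V →ₗ[k] V →ₗ[k] V
  one : Bool → V
  inv : Bool → V →ₗ[k] V
  counit_one : ∀ c, counit (R := k) (one c) = 1
  counit_mul : ∀ c x y,
    counit (R := k) (mul c x y) = counit (R := k) x * counit (R := k) y
  counit_inv : ∀ c x, counit (R := k) (inv c x) = counit (R := k) x
  comul_one : ∀ c, comul (R := k) (one c) = one c ⊗ₜ[k] one c
  comul_mul : ∀ c x y, comul (R := k) (mul c x y) =
    TensorProduct.map₂ (mul c) (mul c) (comul (R := k) x) (comul (R := k) y)
  comul_inv : ∀ c x, comul (R := k) (inv c x) =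
    TensorProduct.map (inv c) (inv c) (comul (R := k) x)

namespace CoalgOps

theorem map_lift_tensorTensorTensorComm {k V W X Y : Type u} [Field k]
    [AddCommGroup V] [Module k V] [AddCommGroup W] [Module k W]
    [AddCommGroup X] [Module k X] [AddCommGroup Y] [Module k Y] (m : V →ₗ[k] W →ₗ[k] X)
    (n : V →ₗ[k] W →ₗ[k] Y) (s : V ⊗[k] V) (t : W ⊗[k] W) :
    TensorProduct.map (TensorProduct.lift m) (TensorProduct.lift n)
      (TensorProduct.AlgebraTensorModule.tensorTensorTensorComm k k k k V V W W (s ⊗ₜ t)) =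
    TensorProduct.map₂ m n s t := by
  induction s using TensorProduct.induction_on with
  | zero => simp
  | add a b ha hb => simp [TensorProduct.add_tmul, ha, hb]
  | tmul a b =>
    induction t using TensorProduct.induction_on with
    | zero => simp
    | add c d hc hd => simp [TensorProduct.tmul_add, hc, hd]
    | tmul c d => simp

variable {k V : Type u} [Field k] [AddCommGroup V] [Module k V] [Coalgebra k V]

variable (O : CoalgOps k V)

/-- The binary operations as morphisms of coalgebras. -/
noncomputable def mulHom (c : Bool) : V ⊗[k] V →ₗc[k] V where
  __ := TensorProduct.lift (O.mul c)
  counit_comp := by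
    ext x y
    simp [O.counit_mul, mul_comm]
  map_comp_comul := by
    ext x y
    simp [O.comul_mul, map_lift_tensorTensorTensorComm]

@[simp]
theorem mulHom_tmul (c : Bool) (x y : V) : O.mulHom c (x ⊗ₜ y) = O.mul c x y := rfl

/-- The unary operations as morphisms of coalgebras. -/
noncomputable def invHom (c : Bool) : V →ₗc[k] V where
  __ := O.inv c
  counit_comp := by
    ext x
    simp [O.counit_inv]
  map_comp_comul := by
    ext x
    simp [O.comul_inv]

@[simp]
theorem invHom_apply (c : Bool) (x : V) : O.invHom c x = O.inv c x := rfl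

/-- The constants as morphisms of coalgebras. -/
noncomputable def oneHom (c : Bool) : k →ₗc[k] V where
  __ := LinearMap.toSpanSingleton k V (O.one c)
  counit_comp := by
    ext
    simp [O.counit_one]
  map_comp_comul := by
    ext
    simp [O.comul_one]

@[simp]
theorem oneHom_apply (c : Bool) (r : k) : O.oneHom c r = r • O.one c := rfl

/-- The convolution of two morphisms of coalgebras on a cocommutative coalgebra. -/
noncomputable def conv {D : Type u} [AddCommGroup D] [Module k D] [Coalgebra k D] [IsCocomm k D]
    (c : Bool) (f g : D →ₗc[k] V) : D →ₗc[k] V :=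
  (O.mulHom c).comp ((Coalgebra.TensorProduct.map f g).comp (comulCoalgHom k D))

theorem conv_apply {D : Type u} [AddCommGroup D] [Module k D] [Coalgebra k D] [IsCocomm k D]
    (c : Bool) (f g : D →ₗc[k] V) (d : D) :
    O.conv c f g d = TensorProduct.lift (O.mul c)
      (TensorProduct.map (f : D →ₗ[k] V) (g : D →ₗ[k] V) (comul (R := k) d)) := rfl

/-- The projection of a tensor product of coalgebras to the first factor. -/
noncomputable def fstHom (k C D : Type u) [Field k] [AddCommGroup C] [Module k C] [Coalgebra k C]
    [AddCommGroup D] [Module k D] [Coalgebra k D] : C ⊗[k] D →ₗc[k] C :=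
  (Coalgebra.TensorProduct.rid k k C : C ⊗[k] k →ₗc[k] C).comp
    (Coalgebra.TensorProduct.map (.id k C) (counitCoalgHom k D))

@[simp]
theorem fstHom_tmul (C D : Type u) [AddCommGroup C] [Module k C] [Coalgebra k C]
    [AddCommGroup D] [Module k D] [Coalgebra k D] (x : C) (y : D) :
    fstHom k C D (x ⊗ₜ y) = counit (R := k) y • x := rfl

/-- The projection of a tensor product of coalgebras to the second factor. -/
noncomputable def sndHom (k C D : Type u) [Field k] [AddCommGroup C] [Module k C] [Coalgebra k C]
    [AddCommGroup D] [Module k D] [Coalgebra k D] : C ⊗[k] D →ₗc[k] D :=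
  (Coalgebra.TensorProduct.lid k D : k ⊗[k] D →ₗc[k] D).comp
    (Coalgebra.TensorProduct.map (counitCoalgHom k C) (.id k D))

@[simp]
theorem sndHom_tmul (C D : Type u) [AddCommGroup C] [Module k C] [Coalgebra k C]
    [AddCommGroup D] [Module k D] [Coalgebra k D] (x : C) (y : D) :
    sndHom k C D (x ⊗ₜ y) = counit (R := k) x • y := rfl

theorem lid_rTensor_counit_comul (x : V) :
    TensorProduct.lid k V ((counit (R := k)).rTensor V (comul (R := k) x)) = x := by
  simp

theorem rid_lTensor_counit_comul (x : V) :
    TensorProduct.rid k V ((counit (R := k)).lTensor V (comul (R := k) x)) = x := by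
  simp

/-- If `P (x ⊗ y ⊗ z) = ε(z) p(x, y)` and `Q (x ⊗ y ⊗ z) = ε(y) q(x, z)`, then
`P(d₁) Q(d₂) = p(x₁, y) q(x₂, z)` for `d = x ⊗ y ⊗ z`. -/
theorem lift_map_comul_tmul_tmul (m : V →ₗ[k] V →ₗ[k] V) (P Q : V ⊗[k] (V ⊗[k] V) →ₗ[k] V)
    (p q : V →ₗ[k] V →ₗ[k] V)
    (hP : ∀ x y z, P (x ⊗ₜ (y ⊗ₜ z)) = counit (R := k) z • p x y)
    (hQ : ∀ x y z, Q (x ⊗ₜ (y ⊗ₜ z)) = counit (R := k) y • q x z) (x y z : V) :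
    TensorProduct.lift m (TensorProduct.map P Q (comul (R := k) (x ⊗ₜ[k] (y ⊗ₜ[k] z)))) =
      TensorProduct.lift m (TensorProduct.map (p.flip y) (q.flip z) (comul (R := k) x)) := by
  -- With `Δ(x)`, `Δ(y)`, `Δ(z)` replaced by arbitrary tensors the identity is linear in each of
  -- them and can be checked on pure tensors. The counits in `P` and `Q` then contract `Δ(y)` to `y`
  -- and `Δ(z)` to `z`.
  have key : ∀ X Y Z : V ⊗[k] V,
      TensorProduct.lift m (TensorProduct.map P Q
        (TensorProduct.AlgebraTensorModule.tensorTensorTensorComm k k k k V V (V ⊗[k] V) (V ⊗[k] V)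
          (X ⊗ₜ TensorProduct.AlgebraTensorModule.tensorTensorTensorComm k k k k V V V V
            (Y ⊗ₜ Z)))) =
      TensorProduct.lift m (TensorProduct.map
        (p.flip (TensorProduct.rid k V ((counit (R := k)).lTensor V Y)))
        (q.flip (TensorProduct.lid k V ((counit (R := k)).rTensor V Z))) X) := by
    intro X Y Z
    induction X using TensorProduct.induction_on with
    | zero => simp
    | add a b ha hb => simp only [TensorProduct.add_tmul, map_add, ha, hb]
    | tmul a b =>
      induction Y using TensorProduct.induction_on with
      | zero => simp
      | add c d hc hd =>
        simp only [TensorProduct.add_tmul, TensorProduct.tmul_add, map_add, hc, hd,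
          TensorProduct.map_add_left]
        simp
      | tmul c d =>
        induction Z using TensorProduct.induction_on with
        | zero => simp
        | add e f he hf =>
          simp only [TensorProduct.tmul_add, map_add, he, hf]
          simp
        | tmul e f => simp [hP, hQ, smul_smul, mul_comm]
  have := key (comul x) (comul y) (comul z)
  rw [lid_rTensor_counit_comul, rid_lTensor_counit_comul] at this
  exact this

/-- The map `x ⊗ y ⊗ z ↦ x ⋄ (y · z)` as a morphism of coalgebras. -/
noncomputable def compatLeft : V ⊗[k] (V ⊗[k] V) →ₗc[k] V :=
  (O.mulHom false).comp (Coalgebra.TensorProduct.map (.id k V) (O.mulHom true))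

/-- The map `x ⊗ y ⊗ z ↦ ε(z) ((x₁ ⋄ y) · S(x₂))` as a morphism of coalgebras. -/
noncomputable def compatAux [IsCocomm k V] : V ⊗[k] (V ⊗[k] V) →ₗc[k] V :=
  O.conv true
    ((O.mulHom false).comp (Coalgebra.TensorProduct.map (.id k V) (fstHom k V V)))
    ((O.invHom true).comp (fstHom k V (V ⊗[k] V)))

/-- The map `x ⊗ y ⊗ z ↦ ((x₁ ⋄ y) · S(x₂)) · (x₃ ⋄ z)` as a morphism of coalgebras. -/
noncomputable def compatRight [IsCocomm k V] : V ⊗[k] (V ⊗[k] V) →ₗc[k] V :=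
  O.conv true O.compatAux
    ((O.mulHom false).comp (Coalgebra.TensorProduct.map (.id k V) (sndHom k V V)))

theorem compatAux_tmul [IsCocomm k V] (x y z : V) :
    O.compatAux (x ⊗ₜ (y ⊗ₜ z)) = counit (R := k) z •
      TensorProduct.lift (O.mul true)
        (TensorProduct.map ((O.mul false).flip y) (O.inv true) (comul (R := k) x)) := by
  -- The second bilinear map is `q(x, z) = ε(z) S(x)`.
  rw [compatAux, conv_apply, lift_map_comul_tmul_tmul _ _ _ (O.mul false)
    (LinearMap.lsmul k (V →ₗ[k] V) |>.flip (O.inv true) |>.comp (counit (R := k)) |>.flip)]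
  · rw [← map_smul, ← LinearMap.smul_apply, ← TensorProduct.map_smul_right]
    rfl
  · intro x y z
    simp
  · intro x y z
    simp [smul_smul, mul_comm]

/-- Each of `y` and `z` is used by one factor only, so their comultiplications collapse by
counitality and only the iterated one of `x` survives. This identifies the right side of the brace
identity with a coalgebra morphism. -/
theorem compatRight_tmul [IsCocomm k V] (x y z : V) :
    O.compatRight (x ⊗ₜ (y ⊗ₜ z)) =
      TensorProduct.lift (O.mul true)
        (TensorProduct.map
          (TensorProduct.lift (O.mul true) ∘ₗ
            TensorProduct.map ((O.mul false).flip y) (O.inv true))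
          ((O.mul false).flip z)
          ((comul (R := k) (A := V)).rTensor V (comul (R := k) x))) := by
  rw [compatRight, conv_apply, lift_map_comul_tmul_tmul _ _ _
    (LinearMap.mk₂ k (fun x y => TensorProduct.lift (O.mul true)
        (TensorProduct.map ((O.mul false).flip y) (O.inv true) (comul (R := k) x)))
      (by simp) (by simp) (by simp [TensorProduct.map_add_left])
      (by simp [TensorProduct.map_smul_left]))
    (O.mul false)]
  · rw [← LinearMap.comp_apply (TensorProduct.map _ _) (LinearMap.rTensor _ _),
      LinearMap.map_comp_rTensor]
    rfl
  · exact O.compatAux_tmul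
  · intro x y z
    simp

end CoalgOps

/-! ### The free space with operations and its recursion principle. -/

/-- Terms in two binary operations, two constants and two unary operations. -/
inductive BraceTerm (ι : Type u) : Type u
  | of : ι → BraceTerm ι
  | one : Bool → BraceTerm ι
  | mul : Bool → BraceTerm ι → BraceTerm ι → BraceTerm ι
  | inv : Bool → BraceTerm ι → BraceTerm ι

/-- The vector space freely generated by `H` under two bilinear operations, two constants and two
linear operations. Its basis is formed by the terms over a basis of `H`. -/
def FreeOps (k H : Type u) [Field k] [AddCommGroup H] [Module k H] : Type u :=
  BraceTerm (Module.Basis.ofVectorSpaceIndex k H) →₀ k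

namespace FreeOps

variable {k H : Type u} [Field k] [AddCommGroup H] [Module k H]

noncomputable instance : AddCommGroup (FreeOps k H) :=
  inferInstanceAs (AddCommGroup (BraceTerm (Module.Basis.ofVectorSpaceIndex k H) →₀ k))

noncomputable instance : Module k (FreeOps k H) :=
  inferInstanceAs (Module k (BraceTerm (Module.Basis.ofVectorSpaceIndex k H) →₀ k))

variable (k H) in
/-- The basis of terms. -/
noncomputable def basis :
    Module.Basis (BraceTerm (Module.Basis.ofVectorSpaceIndex k H)) k (FreeOps k H) :=
  .ofRepr (.refl k _)

variable (k H) in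
/-- The inclusion of the generating space. -/
noncomputable def gen : H →ₗ[k] FreeOps k H :=
  (Module.Basis.ofVectorSpace k H).constr k fun i => basis k H (.of i)

theorem basis_of (i : Module.Basis.ofVectorSpaceIndex k H) :
    basis k H (.of i) = gen k H (Module.Basis.ofVectorSpace k H i) := by
  simp only [gen, Module.Basis.constr_basis]

variable (k H) in
/-- The constants. -/
noncomputable def one (c : Bool) : FreeOps k H := basis k H (.one c)

variable (k H) in
/-- The binary operations. -/
noncomputable def mul (c : Bool) : FreeOps k H →ₗ[k] FreeOps k H →ₗ[k] FreeOps k H :=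
  (basis k H).constr k fun s => (basis k H).constr k fun t => basis k H (.mul c s t)

variable (k H) in
/-- The unary operations. -/
noncomputable def inv (c : Bool) : FreeOps k H →ₗ[k] FreeOps k H :=
  (basis k H).constr k fun t => basis k H (.inv c t)

theorem mul_basis (c : Bool) (s t : BraceTerm (Module.Basis.ofVectorSpaceIndex k H)) :
    mul k H c (basis k H s) (basis k H t) = basis k H (.mul c s t) := by
  simp only [mul, Module.Basis.constr_basis]

theorem inv_basis (c : Bool) (t : BraceTerm (Module.Basis.ofVectorSpaceIndex k H)) :
    inv k H c (basis k H t) = basis k H (.inv c t) := by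
  simp only [inv, Module.Basis.constr_basis]

/-- Induction on terms, phrased with arbitrary vectors so that its applications never mention the
chosen basis of `H`. -/
theorem linearMap_ext {W : Type*} [AddCommGroup W] [Module k W] {f g : FreeOps k H →ₗ[k] W}
    (hgen : ∀ h, f (gen k H h) = g (gen k H h)) (hone : ∀ c, f (one k H c) = g (one k H c))
    (hmul : ∀ c x y, f x = g x → f y = g y → f (mul k H c x y) = g (mul k H c x y))
    (hinv : ∀ c x, f x = g x → f (inv k H c x) = g (inv k H c x)) : f = g := by
  refine (basis k H).ext fun t => ?_
  induction t with
  | of i => rw [basis_of, hgen]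
  | one c => exact hone c
  | mul c s t hs ht => rw [← mul_basis, hmul c _ _ hs ht]
  | inv c t ht => rw [← inv_basis, hinv c _ ht]

section Recursion

variable {W : Type*} [AddCommGroup W] [Module k W] (f : H →ₗ[k] W) (o : Bool → W)
  (m : Bool → W →ₗ[k] W →ₗ[k] W) (n : Bool → W →ₗ[k] W)

/-- The value of a term under an interpretation of the operations. -/
noncomputable def interpret : BraceTerm (Module.Basis.ofVectorSpaceIndex k H) → W
  | .of i => f (Module.Basis.ofVectorSpace k H i)
  | .one c => o c
  | .mul c s t => m c (interpret s) (interpret t)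
  | .inv c t => n c (interpret t)

/-- The linear map out of `FreeOps k H` given by an interpretation of the operations. -/
noncomputable def eval : FreeOps k H →ₗ[k] W := (basis k H).constr k (interpret f o m n)

theorem eval_basis (t : BraceTerm (Module.Basis.ofVectorSpaceIndex k H)) :
    eval f o m n (basis k H t) = interpret f o m n t :=
  (basis k H).constr_basis k _ t

@[simp]
theorem eval_gen (h : H) : eval f o m n (gen k H h) = f h := by
  suffices eval f o m n ∘ₗ gen k H = f from LinearMap.congr_fun this h
  refine (Module.Basis.ofVectorSpace k H).ext fun i => ?_
  rw [LinearMap.comp_apply, ← basis_of, eval_basis, interpret]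

@[simp]
theorem eval_one (c : Bool) : eval f o m n (one k H c) = o c := by
  rw [one, eval_basis, interpret]

@[simp]
theorem eval_mul (c : Bool) (x y : FreeOps k H) :
    eval f o m n (mul k H c x y) = m c (eval f o m n x) (eval f o m n y) := by
  suffices (mul k H c).compr₂ (eval f o m n) = (m c).compl₁₂ (eval f o m n) (eval f o m n) from
    LinearMap.congr_fun₂ this x y
  refine (basis k H).ext fun s => (basis k H).ext fun t => ?_
  simp only [LinearMap.compr₂_apply, LinearMap.compl₁₂_apply, mul_basis, eval_basis, interpret]

@[simp]
theorem eval_inv (c : Bool) (x : FreeOps k H) :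
    eval f o m n (inv k H c x) = n c (eval f o m n x) := by
  suffices eval f o m n ∘ₗ inv k H c = n c ∘ₗ eval f o m n from LinearMap.congr_fun this x
  refine (basis k H).ext fun t => ?_
  simp only [LinearMap.comp_apply, inv_basis, eval_basis, interpret]

end Recursion

variable [Coalgebra k H]

/-- Terms are interpreted in the tensor square, with every operation acting on both legs, and in
`k`. No other choice makes `gen` and all operations coalgebra morphisms. -/
noncomputable instance : CoalgebraStruct k (FreeOps k H) where
  comul := eval (TensorProduct.map (gen k H) (gen k H) ∘ₗ comul)
    (fun c => one k H c ⊗ₜ one k H c)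
    (fun c => TensorProduct.map₂ (mul k H c) (mul k H c))
    (fun c => TensorProduct.map (inv k H c) (inv k H c))
  counit := eval counit (fun _ => 1) (fun _ => LinearMap.mul k k) (fun _ => .id)

theorem comul_gen (h : H) : comul (R := k) (gen k H h) =
    TensorProduct.map (gen k H) (gen k H) (comul (R := k) h) := eval_gen _ _ _ _ h

theorem comul_one (c : Bool) : comul (R := k) (one k H c) = one k H c ⊗ₜ[k] one k H c :=
  eval_one _ _ _ _ c

theorem comul_mul (c : Bool) (x y : FreeOps k H) : comul (R := k) (mul k H c x y) =
    TensorProduct.map₂ (mul k H c) (mul k H c) (comul (R := k) x) (comul (R := k) y) :=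
  eval_mul _ _ _ _ c x y

theorem comul_inv (c : Bool) (x : FreeOps k H) : comul (R := k) (inv k H c x) =
    TensorProduct.map (inv k H c) (inv k H c) (comul (R := k) x) := eval_inv _ _ _ _ c x

theorem counit_gen (h : H) : counit (R := k) (gen k H h) = counit (R := k) h :=
  eval_gen _ _ _ _ h

theorem counit_one (c : Bool) : counit (R := k) (one k H c) = 1 := eval_one _ _ _ _ c

theorem counit_mul (c : Bool) (x y : FreeOps k H) : counit (R := k) (mul k H c x y) =
    counit (R := k) x * counit (R := k) y := eval_mul _ _ _ _ c x y

theorem counit_inv (c : Bool) (x : FreeOps k H) : counit (R := k) (inv k H c x) =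
    counit (R := k) x := eval_inv _ _ _ _ c x

end FreeOps

/-! ### Moving operations through tensor products of maps. -/

namespace TensorProduct

variable {k V₁ V₂ W₁ W₂ X₁ X₂ Y₁ Y₂ : Type*} [CommRing k]
  [AddCommGroup V₁] [Module k V₁] [AddCommGroup V₂] [Module k V₂]
  [AddCommGroup W₁] [Module k W₁] [AddCommGroup W₂] [Module k W₂]
  [AddCommGroup X₁] [Module k X₁] [AddCommGroup X₂] [Module k X₂]
  [AddCommGroup Y₁] [Module k Y₁] [AddCommGroup Y₂] [Module k Y₂]

/-- The two legs are independent, so that `Δ` or `ε` may act on one leg and the identity on the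
other. -/
theorem map_map₂_eq_map₂_map {Z₁ Z₂ Z₃ Z₄ : Type*}
    [AddCommGroup Z₁] [Module k Z₁] [AddCommGroup Z₂] [Module k Z₂]
    [AddCommGroup Z₃] [Module k Z₃] [AddCommGroup Z₄] [Module k Z₄]
    {m : V₁ →ₗ[k] W₁ →ₗ[k] X₁} {n : V₂ →ₗ[k] W₂ →ₗ[k] X₂}
    {m' : Z₁ →ₗ[k] Z₂ →ₗ[k] Y₁} {n' : Z₃ →ₗ[k] Z₄ →ₗ[k] Y₂}
    {f : X₁ →ₗ[k] Y₁} {g : X₂ →ₗ[k] Y₂} {a : V₁ →ₗ[k] Z₁} {b : W₁ →ₗ[k] Z₂}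
    {c : V₂ →ₗ[k] Z₃} {d : W₂ →ₗ[k] Z₄}
    (hf : ∀ v w, f (m v w) = m' (a v) (b w)) (hg : ∀ v w, g (n v w) = n' (c v) (d w))
    (s : V₁ ⊗[k] V₂) (t : W₁ ⊗[k] W₂) :
    map f g (map₂ m n s t) = map₂ m' n' (map a c s) (map b d t) := by
  induction s using TensorProduct.induction_on with
  | zero => simp
  | add s s' hs hs' => simp [hs, hs']
  | tmul s s' =>
    induction t using TensorProduct.induction_on with
    | zero => simp
    | add t t' ht ht' => simp only [map_add, ht, ht']
    | tmul t t' => simp [hf, hg]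

theorem map_map_eq_map_map {n : V₁ →ₗ[k] W₁} {f : W₁ →ₗ[k] X₁} {a : V₁ →ₗ[k] Y₁}
    {n' : Y₁ →ₗ[k] X₁} {m : V₂ →ₗ[k] W₂} {g : W₂ →ₗ[k] X₂} {b : V₂ →ₗ[k] Y₂} {m' : Y₂ →ₗ[k] X₂}
    (hf : ∀ v, f (n v) = n' (a v)) (hg : ∀ v, g (m v) = m' (b v)) (t : V₁ ⊗[k] V₂) :
    map f g (map n m t) = map n' m' (map a b t) := by
  induction t using TensorProduct.induction_on with
  | zero => simp
  | add s t hs ht => simp only [map_add, hs, ht]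
  | tmul x y => simp [hf, hg]

theorem assoc_map₂_map₂ {V₃ W₃ X₃ : Type*}
    [AddCommGroup V₃] [Module k V₃] [AddCommGroup W₃] [Module k W₃] [AddCommGroup X₃] [Module k X₃]
    (m : V₁ →ₗ[k] W₁ →ₗ[k] X₁) (n : V₂ →ₗ[k] W₂ →ₗ[k] X₂) (p : V₃ →ₗ[k] W₃ →ₗ[k] X₃)
    (s : (V₁ ⊗[k] V₂) ⊗[k] V₃) (t : (W₁ ⊗[k] W₂) ⊗[k] W₃) :
    TensorProduct.assoc k X₁ X₂ X₃ (map₂ (map₂ m n) p s t) =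
      map₂ m (map₂ n p) (TensorProduct.assoc k V₁ V₂ V₃ s) (TensorProduct.assoc k W₁ W₂ W₃ t) := by
  suffices (map₂ (map₂ m n) p).compr₂ (TensorProduct.assoc k X₁ X₂ X₃).toLinearMap =
      (map₂ m (map₂ n p)).compl₁₂ (TensorProduct.assoc k V₁ V₂ V₃).toLinearMap
        (TensorProduct.assoc k W₁ W₂ W₃).toLinearMap from LinearMap.congr_fun₂ this s t
  ext
  simp

theorem comm_map₂ (m : V₁ →ₗ[k] W₁ →ₗ[k] X₁) (n : V₂ →ₗ[k] W₂ →ₗ[k] X₂)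
    (s : V₁ ⊗[k] V₂) (t : W₁ ⊗[k] W₂) :
    TensorProduct.comm k X₁ X₂ (map₂ m n s t) =
      map₂ n m (TensorProduct.comm k V₁ V₂ s) (TensorProduct.comm k W₁ W₂ t) := by
  suffices (map₂ m n).compr₂ (TensorProduct.comm k X₁ X₂).toLinearMap =
      (map₂ n m).compl₁₂ (TensorProduct.comm k V₁ V₂).toLinearMap
        (TensorProduct.comm k W₁ W₂).toLinearMap from LinearMap.congr_fun₂ this s t
  ext
  simp

end TensorProduct

/-! ### Coalgebra axioms and cocommutativity of the free space. -/

namespace FreeOps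

variable {k H : Type u} [Field k] [AddCommGroup H] [Module k H] [Coalgebra k H]

theorem map_comul_id_mul (c : Bool) (s t : FreeOps k H ⊗[k] FreeOps k H) :
    TensorProduct.map (comul (R := k)) .id (TensorProduct.map₂ (mul k H c) (mul k H c) s t) =
      TensorProduct.map₂ (TensorProduct.map₂ (mul k H c) (mul k H c)) (mul k H c)
        (TensorProduct.map (comul (R := k)) .id s) (TensorProduct.map (comul (R := k)) .id t) :=
  TensorProduct.map_map₂_eq_map₂_map (m' := TensorProduct.map₂ (mul k H c) (mul k H c))
    (n' := mul k H c) (comul_mul c) (fun _ _ => rfl) s t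

theorem map_id_comul_mul (c : Bool) (s t : FreeOps k H ⊗[k] FreeOps k H) :
    TensorProduct.map .id (comul (R := k)) (TensorProduct.map₂ (mul k H c) (mul k H c) s t) =
      TensorProduct.map₂ (mul k H c) (TensorProduct.map₂ (mul k H c) (mul k H c))
        (TensorProduct.map .id (comul (R := k)) s) (TensorProduct.map .id (comul (R := k)) t) :=
  TensorProduct.map_map₂_eq_map₂_map (m' := mul k H c)
    (n' := TensorProduct.map₂ (mul k H c) (mul k H c)) (fun _ _ => rfl) (comul_mul c) s t

theorem map_counit_id_mul (c : Bool) (s t : FreeOps k H ⊗[k] FreeOps k H) :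
    TensorProduct.map (counit (R := k)) .id (TensorProduct.map₂ (mul k H c) (mul k H c) s t) =
      TensorProduct.map₂ (LinearMap.mul k k) (mul k H c)
        (TensorProduct.map (counit (R := k)) .id s) (TensorProduct.map (counit (R := k)) .id t) :=
  TensorProduct.map_map₂_eq_map₂_map (m' := LinearMap.mul k k)
    (n' := mul k H c) (counit_mul c) (fun _ _ => rfl) s t

theorem map_id_counit_mul (c : Bool) (s t : FreeOps k H ⊗[k] FreeOps k H) :
    TensorProduct.map .id (counit (R := k)) (TensorProduct.map₂ (mul k H c) (mul k H c) s t) =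
      TensorProduct.map₂ (mul k H c) (LinearMap.mul k k)
        (TensorProduct.map .id (counit (R := k)) s) (TensorProduct.map .id (counit (R := k)) t) :=
  TensorProduct.map_map₂_eq_map₂_map (m' := mul k H c)
    (n' := LinearMap.mul k k) (fun _ _ => rfl) (counit_mul c) s t

section

variable {C : Type u} [AddCommGroup C] [Module k C] [CoalgebraStruct k C]
  {n : C →ₗ[k] FreeOps k H}

theorem map_comul_id_map
    (hn : ∀ v, comul (R := k) (n v) = TensorProduct.map n n (comul (R := k) v)) (t : C ⊗[k] C) :
    TensorProduct.map (comul (R := k)) .id (TensorProduct.map n n t) =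
      TensorProduct.map (TensorProduct.map n n) n (TensorProduct.map (comul (R := k)) .id t) :=
  TensorProduct.map_map_eq_map_map (g := .id) (m := n) (b := .id) (m' := n) hn (fun _ => rfl) t

theorem map_id_comul_map
    (hn : ∀ v, comul (R := k) (n v) = TensorProduct.map n n (comul (R := k) v)) (t : C ⊗[k] C) :
    TensorProduct.map .id (comul (R := k)) (TensorProduct.map n n t) =
      TensorProduct.map n (TensorProduct.map n n) (TensorProduct.map .id (comul (R := k)) t) :=
  TensorProduct.map_map_eq_map_map (f := .id) (n := n) (a := .id) (n' := n) (fun _ => rfl) hn t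

theorem map_counit_id_map
    (hn : ∀ v, counit (R := k) (n v) = counit (R := k) v) (t : C ⊗[k] C) :
    TensorProduct.map (counit (R := k)) .id (TensorProduct.map n n t) =
      TensorProduct.map .id n (TensorProduct.map (counit (R := k)) .id t) :=
  TensorProduct.map_map_eq_map_map (g := .id) (m := n) (b := .id) (m' := n) hn (fun _ => rfl) t

theorem map_id_counit_map
    (hn : ∀ v, counit (R := k) (n v) = counit (R := k) v) (t : C ⊗[k] C) :
    TensorProduct.map .id (counit (R := k)) (TensorProduct.map n n t) =
      TensorProduct.map n .id (TensorProduct.map .id (counit (R := k)) t) :=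
  TensorProduct.map_map_eq_map_map (f := .id) (n := n) (a := .id) (n' := n) (fun _ => rfl) hn t

end

/-- Both sides commute with the operations, extended legwise to the triple tensor product. This
leaves the constants, which are grouplike, and the generators, where coassociativity of `H` applies.
-/
theorem coassoc_apply' (x : FreeOps k H) :
    TensorProduct.assoc k _ _ _ (TensorProduct.map (comul (R := k)) .id (comul (R := k) x)) =
      TensorProduct.map .id (comul (R := k)) (comul (R := k) x) := by
  suffices (TensorProduct.assoc k _ _ _).toLinearMap ∘ₗ
      TensorProduct.map (comul (R := k)) .id ∘ₗ comul (R := k) (A := FreeOps k H) =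
      TensorProduct.map .id (comul (R := k)) ∘ₗ comul (R := k) from LinearMap.congr_fun this x
  refine linearMap_ext (fun h => ?_) (fun c => ?_) (fun c x y hx hy => ?_) (fun c x hx => ?_) <;>
    simp only [LinearMap.comp_apply, LinearEquiv.coe_coe] at *
  · rw [comul_gen, map_comul_id_map comul_gen, map_id_comul_map comul_gen,
      ← TensorProduct.map_map_assoc]
    exact congrArg _ (coassoc_apply h)
  · simp [comul_one]
  · rw [comul_mul, map_comul_id_mul, map_id_comul_mul, TensorProduct.assoc_map₂_map₂, hx, hy]
  · rw [comul_inv, map_comul_id_map (comul_inv c), map_id_comul_map (comul_inv c),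
      ← TensorProduct.map_map_assoc, hx]

theorem map_counit_id_comul (x : FreeOps k H) :
    TensorProduct.map (counit (R := k)) .id (comul (R := k) x) = 1 ⊗ₜ[k] x := by
  suffices TensorProduct.map (counit (R := k)) .id ∘ₗ comul (R := k) (A := FreeOps k H) =
      TensorProduct.mk k _ _ 1 from LinearMap.congr_fun this x
  refine linearMap_ext (fun h => ?_) (fun c => ?_) (fun c x y hx hy => ?_) (fun c x hx => ?_) <;>
    simp only [LinearMap.comp_apply, TensorProduct.mk_apply] at *
  · rw [comul_gen, map_counit_id_map counit_gen]
    refine (congrArg _ (rTensor_counit_comul h)).trans ?_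
    simp
  · simp [comul_one, counit_one]
  · rw [comul_mul, map_counit_id_mul, hx, hy]
    simp
  · rw [comul_inv, map_counit_id_map (counit_inv c), hx]
    simp

theorem map_id_counit_comul (x : FreeOps k H) :
    TensorProduct.map .id (counit (R := k)) (comul (R := k) x) = x ⊗ₜ[k] 1 := by
  suffices TensorProduct.map .id (counit (R := k)) ∘ₗ comul (R := k) (A := FreeOps k H) =
      (TensorProduct.mk k _ _).flip 1 from LinearMap.congr_fun this x
  refine linearMap_ext (fun h => ?_) (fun c => ?_) (fun c x y hx hy => ?_) (fun c x hx => ?_) <;>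
    simp only [LinearMap.comp_apply, TensorProduct.mk_apply, LinearMap.flip_apply] at *
  · rw [comul_gen, map_id_counit_map counit_gen]
    refine (congrArg _ (lTensor_counit_comul h)).trans ?_
    simp
  · simp [comul_one, counit_one]
  · rw [comul_mul, map_id_counit_mul, hx, hy]
    simp
  · rw [comul_inv, map_id_counit_map (counit_inv c), hx]
    simp

noncomputable instance : Coalgebra k (FreeOps k H) where
  coassoc := LinearMap.ext coassoc_apply'
  rTensor_counit_comp_comul := LinearMap.ext map_counit_id_comul
  lTensor_counit_comp_comul := LinearMap.ext map_id_counit_comul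

instance [IsCocomm k H] : IsCocomm k (FreeOps k H) where
  comm_comp_comul := by
    refine linearMap_ext (fun h => ?_) (fun c => ?_) (fun c x y hx hy => ?_) (fun c x hx => ?_)
    · simp [comul_gen, ← TensorProduct.map_comm]
    · simp [comul_one]
    · simp only [LinearMap.comp_apply, LinearEquiv.coe_coe] at hx hy ⊢
      rw [comul_mul, TensorProduct.comm_map₂, hx, hy]
    · simp only [LinearMap.comp_apply, LinearEquiv.coe_coe] at hx ⊢
      rw [comul_inv, ← TensorProduct.map_comm, hx]

variable (k H) in
/-- The operations of `FreeOps k H`. -/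
noncomputable def ops : CoalgOps k (FreeOps k H) where
  mul := mul k H
  one := one k H
  inv := inv k H
  counit_one := counit_one
  counit_mul := counit_mul
  counit_inv := counit_inv
  comul_one := comul_one
  comul_mul := comul_mul
  comul_inv := comul_inv

variable (k H) in
/-- The inclusion of the generating coalgebra. -/
noncomputable def genHom : H →ₗc[k] FreeOps k H where
  __ := gen k H
  counit_comp := LinearMap.ext counit_gen
  map_comp_comul := LinearMap.ext fun h => (comul_gen h).symm

end FreeOps

/-! ### The coideal of relations and the quotient Hopf brace. -/

namespace CoalgOps

variable {k V H : Type u} [Field k] [AddCommGroup V] [Module k V] [Coalgebra k V]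
  [Ring H] [HopfAlgebra k H]

/-- The elements that have to vanish for the operations to form a Hopf brace and for `γ` to be
multiplicative with respect to the structure `c₀`. The first structure of the Hopf brace has the
index `true` and the second one has the index `false`. -/
inductive Rel (O : CoalgOps k V) (γ : H →ₗc[k] V) (c₀ : Bool) : V → Prop
  | mul_assoc (c : Bool) (x y z : V) :
    Rel O γ c₀ (O.mul c (O.mul c x y) z - O.mul c x (O.mul c y z))
  | one_mul (c : Bool) (x : V) : Rel O γ c₀ (O.mul c (O.one c) x - x)
  | mul_one (c : Bool) (x : V) : Rel O γ c₀ (O.mul c x (O.one c) - x)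
  | antipode_left (c : Bool) (x : V) : Rel O γ c₀
    (TensorProduct.lift (O.mul c) ((O.inv c).rTensor V (comul (R := k) x)) -
      counit (R := k) x • O.one c)
  | antipode_right (c : Bool) (x : V) : Rel O γ c₀
    (TensorProduct.lift (O.mul c) ((O.inv c).lTensor V (comul (R := k) x)) -
      counit (R := k) x • O.one c)
  | compat (x y z : V) : Rel O γ c₀ (O.mul false x (O.mul true y z) -
      TensorProduct.lift (O.mul true)
        (TensorProduct.map
          (TensorProduct.lift (O.mul true) ∘ₗ
            TensorProduct.map ((O.mul false).flip y) (O.inv true))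
          ((O.mul false).flip z)
          ((comul (R := k) (A := V)).rTensor V (comul (R := k) x))))
  | map_one : Rel O γ c₀ (γ 1 - O.one c₀)
  | map_mul (a b : H) : Rel O γ c₀ (γ (a * b) - O.mul c₀ (γ a) (γ b))
  -- Closure under the operations is what lets them descend to the quotient.
  | mul_left (c : Bool) (x y : V) : Rel O γ c₀ x → Rel O γ c₀ (O.mul c x y)
  | mul_right (c : Bool) (x y : V) : Rel O γ c₀ y → Rel O γ c₀ (O.mul c x y)
  | inv (c : Bool) (x : V) : Rel O γ c₀ x → Rel O γ c₀ (O.inv c x)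

variable (O : CoalgOps k V) (γ : H →ₗc[k] V) (c₀ : Bool)

/-- The subspace spanned by the relations. -/
def relSpan : Submodule k V := Submodule.span k {x | O.Rel γ c₀ x}

variable {O γ c₀}

theorem Rel.mem {x : V} (h : O.Rel γ c₀ x) : x ∈ O.relSpan γ c₀ := Submodule.subset_span h

theorem Rel.mk_eq {x y : V} (h : O.Rel γ c₀ (x - y)) :
    (O.relSpan γ c₀).mkQ x = (O.relSpan γ c₀).mkQ y :=
  (Submodule.Quotient.eq _).2 h.mem

variable (O γ c₀)

theorem mul_left_mem (c : Bool) {x : V} (y : V) (hx : x ∈ O.relSpan γ c₀) :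
    O.mul c x y ∈ O.relSpan γ c₀ := by
  induction hx using Submodule.span_induction with
  | mem x hx => exact (Rel.mul_left c x y hx).mem
  | zero => simp
  | add a b _ _ ha hb => simpa using add_mem ha hb
  | smul r a _ ha => simpa using Submodule.smul_mem _ r ha

theorem mul_right_mem (c : Bool) (x : V) {y : V} (hy : y ∈ O.relSpan γ c₀) :
    O.mul c x y ∈ O.relSpan γ c₀ := by
  induction hy using Submodule.span_induction with
  | mem y hy => exact (Rel.mul_right c x y hy).mem
  | zero => simp
  | add a b _ _ ha hb => simpa using add_mem ha hb
  | smul r a _ ha => simpa using Submodule.smul_mem _ r ha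

theorem inv_mem (c : Bool) {x : V} (hx : x ∈ O.relSpan γ c₀) :
    O.inv c x ∈ O.relSpan γ c₀ := by
  induction hx using Submodule.span_induction with
  | mem x hx => exact (Rel.inv c x hx).mem
  | zero => simp
  | add a b _ _ ha hb => simpa using add_mem ha hb
  | smul r a _ ha => simpa using Submodule.smul_mem _ r ha

/-- The quotient by the relations. -/
abbrev Quot : Type u := V ⧸ O.relSpan γ c₀

/-- The quotient map. -/
abbrev proj : V →ₗ[k] O.Quot γ c₀ := (O.relSpan γ c₀).mkQ

/-- The binary operations of the quotient. -/
noncomputable def quotMul (c : Bool) : O.Quot γ c₀ →ₗ[k] O.Quot γ c₀ →ₗ[k] O.Quot γ c₀ :=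
  (O.relSpan γ c₀).liftQ
    (LinearMap.flip ((O.relSpan γ c₀).liftQ ((O.mul c).compr₂ (O.proj γ c₀)).flip fun y hy => by
      ext x
      exact (Submodule.Quotient.mk_eq_zero _).2 (O.mul_right_mem γ c₀ c x hy))) fun x hx => by
    ext y
    exact (Submodule.Quotient.mk_eq_zero _).2 (O.mul_left_mem γ c₀ c y hx)

/-- The unary operations of the quotient. -/
noncomputable def quotInv (c : Bool) : O.Quot γ c₀ →ₗ[k] O.Quot γ c₀ :=
  (O.relSpan γ c₀).mapQ _ (O.inv c) fun _ hx => O.inv_mem γ c₀ c hx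

theorem proj_mul (c : Bool) (x y : V) : O.proj γ c₀ (O.mul c x y) =
    O.quotMul γ c₀ c (O.proj γ c₀ x) (O.proj γ c₀ y) := rfl

theorem proj_inv (c : Bool) (x : V) : O.proj γ c₀ (O.inv c x) =
    O.quotInv γ c₀ c (O.proj γ c₀ x) := rfl

theorem proj_lift_mul (c : Bool) (t : V ⊗[k] V) :
    O.proj γ c₀ (TensorProduct.lift (O.mul c) t) =
      TensorProduct.lift (O.quotMul γ c₀ c)
        (TensorProduct.map (O.proj γ c₀) (O.proj γ c₀) t) := by
  suffices O.proj γ c₀ ∘ₗ TensorProduct.lift (O.mul c) = TensorProduct.lift (O.quotMul γ c₀ c) ∘ₗ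
      TensorProduct.map (O.proj γ c₀) (O.proj γ c₀) from LinearMap.congr_fun this t
  exact TensorProduct.ext' fun x y => O.proj_mul γ c₀ c x y

theorem map_proj_comul_mul (c : Bool) (x y : V) :
    TensorProduct.map (O.proj γ c₀) (O.proj γ c₀) (comul (R := k) (O.mul c x y)) =
      TensorProduct.map₂ (O.quotMul γ c₀ c) (O.quotMul γ c₀ c)
        (TensorProduct.map (O.proj γ c₀) (O.proj γ c₀) (comul (R := k) x))
        (TensorProduct.map (O.proj γ c₀) (O.proj γ c₀) (comul (R := k) y)) := by
  rw [O.comul_mul, TensorProduct.map_map₂_eq_map₂_map (O.proj_mul γ c₀ c) (O.proj_mul γ c₀ c)]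

theorem map_proj_comul_inv (c : Bool) (x : V) :
    TensorProduct.map (O.proj γ c₀) (O.proj γ c₀) (comul (R := k) (O.inv c x)) =
      TensorProduct.map (O.quotInv γ c₀ c) (O.quotInv γ c₀ c)
        (TensorProduct.map (O.proj γ c₀) (O.proj γ c₀) (comul (R := k) x)) := by
  rw [O.comul_inv, TensorProduct.map_map_eq_map_map (O.proj_inv γ c₀ c) (O.proj_inv γ c₀ c)]

/-- With `π` the quotient map, `(π ⊗ π) Δ(L d) = (πL ⊗ πL) Δ(d)`, which depends only on `πL = πR`.
The agreement is needed on all of `D`, since `Δ(d)` involves other elements. -/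
theorem coideal_of_coalgHom {D : Type u} [AddCommGroup D] [Module k D] [Coalgebra k D]
    (I : Submodule k V) (L R : D →ₗc[k] V) (h : I.mkQ ∘ₗ (L : D →ₗ[k] V) = I.mkQ ∘ₗ (R : D →ₗ[k] V))
    (d : D) : counit (R := k) (L d - R d) = 0 ∧
      TensorProduct.map I.mkQ I.mkQ (comul (R := k) (L d - R d)) = 0 := by
  constructor
  · simp
  · rw [map_sub, map_sub, ← CoalgHomClass.map_comp_comul_apply L,
      ← CoalgHomClass.map_comp_comul_apply R, TensorProduct.map_map, TensorProduct.map_map, h,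
      sub_self]

/-- Each identity is imposed for all arguments, so its sides are coalgebra morphisms that agree
modulo the span. Cocommutativity serves the antipode and brace identities, which repeat a variable.
For the closure rules, `(π ⊗ π) ∘ Δ` commutes with the operations. -/
theorem counit_eq_zero_and_map_proj_comul_eq_zero [IsCocomm k V] {x : V} (hx : O.Rel γ c₀ x) :
    counit (R := k) x = 0 ∧
      TensorProduct.map (O.proj γ c₀) (O.proj γ c₀) (comul (R := k) x) = 0 := by
  induction hx with
  | mul_assoc c x y z =>
    exact coideal_of_coalgHom (O.relSpan γ c₀)
      ((O.mulHom c).comp (Coalgebra.TensorProduct.map (O.mulHom c) (.id k V)))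
      ((O.mulHom c).comp ((Coalgebra.TensorProduct.map (.id k V) (O.mulHom c)).comp
        (Coalgebra.TensorProduct.assoc k k V V V :
          (V ⊗[k] V) ⊗[k] V →ₗc[k] V ⊗[k] (V ⊗[k] V))))
      (TensorProduct.ext_threefold fun x y z =>
        (Rel.mul_assoc (O := O) (γ := γ) (c₀ := c₀) c x y z).mk_eq) ((x ⊗ₜ y) ⊗ₜ z)
  | one_mul c x =>
    -- The constant enters as a morphism from `k`, so the identity lives on `k ⊗ V` and is evaluated
    -- at `1 ⊗ x`.
    have := coideal_of_coalgHom (O.relSpan γ c₀)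
      ((O.mulHom c).comp (Coalgebra.TensorProduct.map (O.oneHom c) (.id k V)))
      (Coalgebra.TensorProduct.lid k V : k ⊗[k] V →ₗc[k] V)
      (TensorProduct.ext <| LinearMap.ext_ring <| LinearMap.ext fun x => ?_) (1 ⊗ₜ x)
    · simpa using this
    · have := (Rel.one_mul (O := O) (γ := γ) (c₀ := c₀) c x).mk_eq
      simpa using this
  | mul_one c x =>
    have := coideal_of_coalgHom (O.relSpan γ c₀)
      ((O.mulHom c).comp (Coalgebra.TensorProduct.map (.id k V) (O.oneHom c)))
      (Coalgebra.TensorProduct.rid k k V : V ⊗[k] k →ₗc[k] V)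
      (TensorProduct.ext <| LinearMap.ext fun x => LinearMap.ext_ring ?_) (x ⊗ₜ 1)
    · simpa using this
    · have := (Rel.mul_one (O := O) (γ := γ) (c₀ := c₀) c x).mk_eq
      simpa using this
  | antipode_left c x =>
    exact coideal_of_coalgHom _ (O.conv c (O.invHom c) (.id k V))
      ((O.oneHom c).comp (counitCoalgHom k V))
      (LinearMap.ext fun x => (Rel.antipode_left c x).mk_eq) x
  | antipode_right c x =>
    exact coideal_of_coalgHom _ (O.conv c (.id k V) (O.invHom c))
      ((O.oneHom c).comp (counitCoalgHom k V))
      (LinearMap.ext fun x => (Rel.antipode_right c x).mk_eq) x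
  | compat x y z =>
    rw [← O.compatRight_tmul]
    refine coideal_of_coalgHom _ O.compatLeft O.compatRight
      (TensorProduct.ext <| LinearMap.ext fun x => TensorProduct.ext' fun y z => ?_)
      (x ⊗ₜ (y ⊗ₜ z))
    have := (Rel.compat (O := O) (γ := γ) (c₀ := c₀) x y z).mk_eq
    rw [← O.compatRight_tmul] at this
    exact this
  | map_one =>
    have := coideal_of_coalgHom (O.relSpan γ c₀)
      (γ.comp (Bialgebra.unitBialgHom k H : k →ₗc[k] H)) (O.oneHom c₀)
      (LinearMap.ext_ring ?_) 1
    · simpa using this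
    · have := (Rel.map_one (O := O) (γ := γ) (c₀ := c₀)).mk_eq
      simpa using this
  | map_mul a b =>
    exact coideal_of_coalgHom _ (γ.comp (Bialgebra.mulCoalgHom k H))
      ((O.mulHom c₀).comp (Coalgebra.TensorProduct.map γ γ))
      (TensorProduct.ext' fun a b => (Rel.map_mul a b).mk_eq) (a ⊗ₜ b)
  | mul_left c x y _ ih =>
    rw [O.map_proj_comul_mul, O.counit_mul, ih.1, ih.2]
    simp
  | mul_right c x y _ ih =>
    rw [O.map_proj_comul_mul, O.counit_mul, ih.1, ih.2]
    simp
  | inv c x _ ih =>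
    rw [O.map_proj_comul_inv, O.counit_inv, ih.1, ih.2]
    simp

instance [IsCocomm k V] : (O.relSpan γ c₀).IsCoideal where
  counit_eq_zero x hx := by
    induction hx using Submodule.span_induction with
    | mem x hx => exact (O.counit_eq_zero_and_map_proj_comul_eq_zero γ c₀ hx).1
    | zero => simp
    | add a b _ _ ha hb => rw [map_add, ha, hb, add_zero]
    | smul r a _ ha => rw [map_smul, ha, smul_zero]
  map_mkQ_comul_eq_zero x hx := by
    induction hx using Submodule.span_induction with
    | mem x hx => exact (O.counit_eq_zero_and_map_proj_comul_eq_zero γ c₀ hx).2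
    | zero => simp
    | add a b _ _ ha hb => rw [map_add, map_add, ha, hb, add_zero]
    | smul r a _ ha => rw [map_smul, map_smul, ha, smul_zero]

theorem Quot.ind {P : O.Quot γ c₀ → Prop} (h : ∀ x, P (O.proj γ c₀ x)) (q : O.Quot γ c₀) : P q :=
  Submodule.Quotient.induction_on _ q h

variable [IsCocomm k V]

instance : IsCocomm k (O.Quot γ c₀) where
  comm_comp_comul := by
    refine LinearMap.ext <| Quot.ind O γ c₀ fun x => ?_
    change TensorProduct.comm k _ _ (TensorProduct.map _ _ (comul (R := k) x)) =
      TensorProduct.map _ _ (comul (R := k) x)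
    rw [← TensorProduct.map_comm, comm_comul]

/-- The Hopf algebra structures on the quotient. -/
noncomputable def quotStructure (c : Bool) : HopfStructure k (O.Quot γ c₀) where
  mul := O.quotMul γ c₀ c
  one := O.proj γ c₀ (O.one c)
  antipode := O.quotInv γ c₀ c
  mul_assoc := Quot.ind O γ c₀ fun x => Quot.ind O γ c₀ fun y => Quot.ind O γ c₀ fun z =>
    (Rel.mul_assoc c x y z).mk_eq
  one_mul := Quot.ind O γ c₀ fun x => (Rel.one_mul c x).mk_eq
  mul_one := Quot.ind O γ c₀ fun x => (Rel.mul_one c x).mk_eq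
  counit_one := O.counit_one c
  counit_mul := Quot.ind O γ c₀ fun x => Quot.ind O γ c₀ fun y => O.counit_mul c x y
  comul_one := (congrArg _ (O.comul_one c)).trans (TensorProduct.map_tmul _ _ _ _)
  comul_mul := Quot.ind O γ c₀ fun x => Quot.ind O γ c₀ fun y => O.map_proj_comul_mul γ c₀ c x y
  antipode_left := Quot.ind O γ c₀ fun x => by
    refine Eq.trans (congrArg (TensorProduct.lift (O.quotMul γ c₀ c)) ?_)
      ((O.proj_lift_mul γ c₀ c _).symm.trans (Rel.antipode_left c x).mk_eq)
    exact (TensorProduct.map_map_eq_map_map (O.proj_inv γ c₀ c) (g := O.proj γ c₀) (m := .id)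
      (b := O.proj γ c₀) (m' := .id) (fun _ => rfl) _).symm
  antipode_right := Quot.ind O γ c₀ fun x => by
    refine Eq.trans (congrArg (TensorProduct.lift (O.quotMul γ c₀ c)) ?_)
      ((O.proj_lift_mul γ c₀ c _).symm.trans (Rel.antipode_right c x).mk_eq)
    exact (TensorProduct.map_map_eq_map_map (f := O.proj γ c₀) (n := .id)
      (a := O.proj γ c₀) (n' := .id) (fun _ => rfl) (O.proj_inv γ c₀ c) _).symm

/-- The Hopf brace on the quotient. -/
noncomputable def quotBrace : HopfBrace k (O.Quot γ c₀) where
  fst := O.quotStructure γ c₀ true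
  snd := O.quotStructure γ c₀ false
  compat := Quot.ind O γ c₀ fun x => Quot.ind O γ c₀ fun y => Quot.ind O γ c₀ fun z => by
    refine (Rel.compat x y z).mk_eq.trans ((O.proj_lift_mul γ c₀ true _).trans ?_)
    refine congrArg (TensorProduct.lift (O.quotMul γ c₀ true)) ?_
    -- The projection moves inward: past the outer factors, then past the inner product and the
    -- antipode, and finally past the second comultiplication of `x`.
    refine (TensorProduct.map_map_eq_map_map (f := O.proj γ c₀) (g := O.proj γ c₀)
      (n := TensorProduct.lift (O.mul true) ∘ₗ
        TensorProduct.map ((O.mul false).flip y) (O.inv true)) (m := (O.mul false).flip z)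
      (a := TensorProduct.map (O.proj γ c₀) (O.proj γ c₀)) (b := O.proj γ c₀)
      (n' := TensorProduct.lift (O.quotMul γ c₀ true) ∘ₗ TensorProduct.map
        ((O.quotMul γ c₀ false).flip (O.proj γ c₀ y)) (O.quotInv γ c₀ true))
      (m' := (O.quotMul γ c₀ false).flip (O.proj γ c₀ z))
      (fun t => (O.proj_lift_mul γ c₀ true _).trans (congrArg _ ?_)) (fun v => rfl) _).trans
        (congrArg _ ?_)
    · exact TensorProduct.map_map_eq_map_map (f := O.proj γ c₀) (n := (O.mul false).flip y)
        (a := O.proj γ c₀) (n' := (O.quotMul γ c₀ false).flip (O.proj γ c₀ y)) (fun _ => rfl) (O.proj_inv γ c₀ true) t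
    · exact (TensorProduct.map_map_eq_map_map (f := comul (R := k)) (n := O.proj γ c₀)
        (a := comul (R := k)) (n' := TensorProduct.map (O.proj γ c₀) (O.proj γ c₀))
        (g := .id) (m := O.proj γ c₀) (b := .id) (m' := O.proj γ c₀) (fun _ => rfl)
        (fun _ => rfl) _).symm

end CoalgOps

/-! ### Antipodes of Hopf structures. -/

namespace HopfStructure

variable {k V W : Type u} [Field k] [AddCommGroup V] [Module k V] [Coalgebra k V]
  [AddCommGroup W] [Module k W] [Coalgebra k W]

theorem counit_antipode (s : HopfStructure k V) (x : V) :
    counit (R := k) (s.antipode x) = counit (R := k) x :=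
  HopfAlgebra.counit_antipode (R := k) (A := s.Carrier) x

theorem comul_antipode [IsCocomm k V] (s : HopfStructure k V) (x : V) :
    comul (R := k) (s.antipode x) =
      TensorProduct.map s.antipode s.antipode (comul (R := k) x) := by
  have : IsCocomm k s.Carrier := inferInstanceAs (IsCocomm k V)
  exact HopfAlgebra.comul_antipode (R := k) (A := s.Carrier) x

theorem map_antipode (s : HopfStructure k V) (t : HopfStructure k W) (g : V →ₗc[k] W)
    (hone : g s.one = t.one) (hmul : ∀ x y, g (s.mul x y) = t.mul (g x) (g y)) (x : V) :
    g (s.antipode x) = t.antipode (g x) := by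
  let g' : s.Carrier →ₐc[k] t.Carrier :=
    { toCoalgHom := g
      map_one' := hone
      map_mul' := hmul }
  exact HopfAlgebra.map_antipode (R := k) g' x

end HopfStructure

/-! ### Evaluation in a Hopf brace and the universal property. -/

namespace HopfBrace

variable {k W : Type u} [Field k] [AddCommGroup W] [Module k W] [Coalgebra k W]

/-- The two structures of a Hopf brace as a family. -/
def str (B : HopfBrace k W) : Bool → HopfStructure k W
  | true => B.fst
  | false => B.snd

variable {H : Type u} [Ring H] [HopfAlgebra k H] (B : HopfBrace k W) (f : H →ₗc[k] W)

/-- The evaluation of formal expressions in a Hopf brace. -/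
noncomputable def evalLinear : FreeOps k H →ₗ[k] W :=
  FreeOps.eval (f : H →ₗ[k] W) (fun c => (B.str c).one) (fun c => (B.str c).mul)
    (fun c => (B.str c).antipode)

theorem evalLinear_gen (h : H) : B.evalLinear f (FreeOps.genHom k H h) = f h :=
  FreeOps.eval_gen _ _ _ _ h

theorem evalLinear_one (c : Bool) :
    B.evalLinear f ((FreeOps.ops k H).one c) = (B.str c).one :=
  FreeOps.eval_one _ _ _ _ c

theorem evalLinear_mul (c : Bool) (x y : FreeOps k H) :
    B.evalLinear f ((FreeOps.ops k H).mul c x y) =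
      (B.str c).mul (B.evalLinear f x) (B.evalLinear f y) :=
  FreeOps.eval_mul _ _ _ _ c x y

theorem evalLinear_inv (c : Bool) (x : FreeOps k H) :
    B.evalLinear f ((FreeOps.ops k H).inv c x) = (B.str c).antipode (B.evalLinear f x) :=
  FreeOps.eval_inv _ _ _ _ c x

/-- The evaluation of formal expressions in a cocommutative Hopf brace as a morphism of
coalgebras. -/
noncomputable def evalHom [IsCocomm k W] : FreeOps k H →ₗc[k] W where
  __ := B.evalLinear f
  counit_comp := by
    refine FreeOps.linearMap_ext (fun h => ?_) (fun c => ?_) (fun c x y hx hy => ?_)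
      (fun c x hx => ?_) <;> simp only [LinearMap.comp_apply] at *
    · exact (congrArg _ (B.evalLinear_gen f h)).trans
        ((CoalgHomClass.counit_comp_apply f h).trans (FreeOps.counit_gen h).symm)
    · exact (congrArg _ (B.evalLinear_one f c)).trans
        ((B.str c).counit_one.trans (FreeOps.counit_one c).symm)
    · refine (congrArg _ (B.evalLinear_mul f c x y)).trans ?_
      rw [(B.str c).counit_mul, hx, hy, FreeOps.counit_mul]
    · refine (congrArg _ (B.evalLinear_inv f c x)).trans ?_
      rw [(B.str c).counit_antipode, hx, FreeOps.counit_inv]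
  map_comp_comul := by
    refine FreeOps.linearMap_ext (fun h => ?_) (fun c => ?_) (fun c x y hx hy => ?_)
      (fun c x hx => ?_) <;> simp only [LinearMap.comp_apply] at *
    · refine Eq.trans ?_ (congrArg _ (B.evalLinear_gen f h)).symm
      rw [FreeOps.comul_gen, ← CoalgHomClass.map_comp_comul_apply f, TensorProduct.map_map]
      congr 2 <;> exact LinearMap.ext (B.evalLinear_gen f)
    · refine Eq.trans ?_ (congrArg _ (B.evalLinear_one f c)).symm
      rw [FreeOps.comul_one, (B.str c).comul_one]
      exact congrArg₂ (· ⊗ₜ[k] ·) (B.evalLinear_one f c) (B.evalLinear_one f c)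
    · refine Eq.trans ?_ (congrArg _ (B.evalLinear_mul f c x y)).symm
      rw [FreeOps.comul_mul, (B.str c).comul_mul, ← hx, ← hy]
      exact TensorProduct.map_map₂_eq_map₂_map (B.evalLinear_mul f c) (B.evalLinear_mul f c) _ _
    · refine Eq.trans ?_ (congrArg _ (B.evalLinear_inv f c x)).symm
      -- Cocommutativity of `W` enters here: in general an antipode reverses the comultiplication.
      rw [FreeOps.comul_inv, (B.str c).comul_antipode, ← hx]
      exact TensorProduct.map_map_eq_map_map (B.evalLinear_inv f c) (B.evalLinear_inv f c) _

variable {f} {c₀ : Bool}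

theorem evalLinear_lift_mul (c : Bool) (t : FreeOps k H ⊗[k] FreeOps k H) :
    B.evalLinear f (TensorProduct.lift ((FreeOps.ops k H).mul c) t) =
      TensorProduct.lift (B.str c).mul
        (TensorProduct.map (B.evalLinear f) (B.evalLinear f) t) := by
  suffices B.evalLinear f ∘ₗ TensorProduct.lift ((FreeOps.ops k H).mul c) =
      TensorProduct.lift (B.str c).mul ∘ₗ TensorProduct.map (B.evalLinear f) (B.evalLinear f)
    from LinearMap.congr_fun this t
  exact TensorProduct.ext' fun x y => B.evalLinear_mul f c x y

/-- Evaluation commutes with the operations, `Δ` and `ε`, so it turns each defect into the defect of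
an axiom of `B` or of the multiplicativity of `f`. Its kernel respects the closure rules. -/
theorem evalLinear_eq_zero [IsCocomm k W] (hone : f 1 = (B.str c₀).one)
    (hmul : ∀ a b, f (a * b) = (B.str c₀).mul (f a) (f b)) {x : FreeOps k H}
    (hx : (FreeOps.ops k H).Rel (FreeOps.genHom k H) c₀ x) : B.evalLinear f x = 0 := by
  have hcomul : ∀ x, comul (R := k) (B.evalLinear f x) =
      TensorProduct.map (B.evalLinear f) (B.evalLinear f) (comul (R := k) x) := fun x =>
    (CoalgHomClass.map_comp_comul_apply (B.evalHom f) x).symm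
  have hcounit : ∀ x, counit (R := k) (B.evalLinear f x) = counit (R := k) x :=
    CoalgHomClass.counit_comp_apply (B.evalHom f)
  induction hx with
  | mul_assoc c x y z => simp only [map_sub, evalLinear_mul, (B.str c).mul_assoc, sub_self]
  | one_mul c x => simp only [map_sub, evalLinear_mul, evalLinear_one, (B.str c).one_mul, sub_self]
  | mul_one c x => simp only [map_sub, evalLinear_mul, evalLinear_one, (B.str c).mul_one, sub_self]
  | antipode_left c x =>
    rw [map_sub, sub_eq_zero, evalLinear_lift_mul, map_smul, evalLinear_one, ← hcounit,
      ← (B.str c).antipode_left, hcomul]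
    exact congrArg _ (TensorProduct.map_map_eq_map_map (B.evalLinear_inv f c)
      (g := B.evalLinear f) (m := .id) (b := B.evalLinear f) (m' := .id) (fun _ => rfl) _)
  | antipode_right c x =>
    rw [map_sub, sub_eq_zero, evalLinear_lift_mul, map_smul, evalLinear_one, ← hcounit,
      ← (B.str c).antipode_right, hcomul]
    exact congrArg _ (TensorProduct.map_map_eq_map_map (f := B.evalLinear f) (n := .id)
      (a := B.evalLinear f) (n' := .id) (fun _ => rfl) (B.evalLinear_inv f c) _)
  | compat x y z =>
    rw [map_sub, sub_eq_zero, evalLinear_lift_mul, evalLinear_mul, evalLinear_mul]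
    refine (B.compat _ _ _).trans (congrArg (TensorProduct.lift B.fst.mul) ?_)
    refine Eq.symm <| (TensorProduct.map_map_eq_map_map
      (f := B.evalLinear f) (g := B.evalLinear f)
      (n := TensorProduct.lift ((FreeOps.ops k H).mul true) ∘ₗ
        TensorProduct.map (((FreeOps.ops k H).mul false).flip y) ((FreeOps.ops k H).inv true))
      (m := ((FreeOps.ops k H).mul false).flip z)
      (a := TensorProduct.map (B.evalLinear f) (B.evalLinear f)) (b := B.evalLinear f)
      (n' := TensorProduct.lift B.fst.mul ∘ₗ TensorProduct.map
        (B.snd.mul.flip (B.evalLinear f y)) B.fst.antipode)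
      (m' := B.snd.mul.flip (B.evalLinear f z))
      (fun t => (B.evalLinear_lift_mul true _).trans (congrArg (TensorProduct.lift B.fst.mul) ?_))
      (fun v => B.evalLinear_mul f false v z) _).trans (congrArg _ ?_)
    · exact TensorProduct.map_map_eq_map_map (f := B.evalLinear f)
        (n := ((FreeOps.ops k H).mul false).flip y)
        (a := B.evalLinear f) (n' := B.snd.mul.flip (B.evalLinear f y))
        (fun v => B.evalLinear_mul f false v y) (B.evalLinear_inv f true) t
    · rw [hcomul]
      exact (TensorProduct.map_map_eq_map_map (f := comul (R := k)) (n := B.evalLinear f)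
        (a := comul (R := k)) (n' := TensorProduct.map (B.evalLinear f) (B.evalLinear f))
        (g := .id) (m := B.evalLinear f) (b := .id) (m' := B.evalLinear f) hcomul
        (fun _ => rfl) _).symm
  | map_one => rw [map_sub, evalLinear_gen, evalLinear_one, hone, sub_self]
  | map_mul a b =>
    rw [map_sub, evalLinear_mul, evalLinear_gen, evalLinear_gen, evalLinear_gen, hmul, sub_self]
  | mul_left c x y _ ih => rw [evalLinear_mul, ih, LinearMap.map_zero₂]
  | mul_right c x y _ ih => rw [evalLinear_mul, ih, map_zero]
  | inv c x _ ih => rw [evalLinear_inv, ih, map_zero]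

variable (k H c₀) in
/-- The underlying coalgebra of the free Hopf brace on the Hopf algebra `H`. -/
abbrev Free : Type u := (FreeOps.ops k H).Quot (FreeOps.genHom k H) c₀

variable (k H c₀) in
/-- The unit of the free Hopf brace. -/
noncomputable def freeUnit [IsCocomm k H] : H →ₗc[k] Free k H c₀ :=
  (Coalgebra.Quotient.mkQCoalgHom _).comp (FreeOps.genHom k H)

variable (k H c₀) in
/-- The free Hopf brace on the Hopf algebra `H`, considered as the first structure if `c₀` is
`true` and as the second one if `c₀` is `false`. -/
noncomputable def free [IsCocomm k H] : HopfBrace k (Free k H c₀) :=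
  (FreeOps.ops k H).quotBrace (FreeOps.genHom k H) c₀

theorem free_str [IsCocomm k H] (c : Bool) : (free k H c₀).str c =
    (FreeOps.ops k H).quotStructure (FreeOps.genHom k H) c₀ c := by
  cases c <;> rfl

theorem freeUnit_one [IsCocomm k H] : freeUnit k H c₀ 1 = ((free k H c₀).str c₀).one := by
  rw [free_str]
  exact CoalgOps.Rel.map_one.mk_eq

theorem freeUnit_mul [IsCocomm k H] (a b : H) : freeUnit k H c₀ (a * b) =
    ((free k H c₀).str c₀).mul (freeUnit k H c₀ a) (freeUnit k H c₀ b) := by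
  rw [free_str]
  exact (CoalgOps.Rel.map_mul a b).mk_eq

theorem existsUnique_coalgHom [IsCocomm k H] [IsCocomm k W] (hone : f 1 = (B.str c₀).one)
    (hmul : ∀ a b, f (a * b) = (B.str c₀).mul (f a) (f b)) :
    ∃! g : Free k H c₀ →ₗc[k] W, ((∀ c, g ((free k H c₀).str c).one = (B.str c).one) ∧
      ∀ c x y, g (((free k H c₀).str c).mul x y) = (B.str c).mul (g x) (g y)) ∧
      ∀ h, g (freeUnit k H c₀ h) = f h := by
  have hle : (FreeOps.ops k H).relSpan (FreeOps.genHom k H) c₀ ≤ LinearMap.ker (B.evalLinear f) :=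
    Submodule.span_le.2 fun x hx => B.evalLinear_eq_zero hone hmul hx
  refine ⟨⟨Submodule.liftQ _ (B.evalLinear f) hle, ?_, ?_⟩, ⟨⟨fun c => ?_, fun c => ?_⟩, ?_⟩, ?_⟩
  · refine LinearMap.ext <| CoalgOps.Quot.ind _ _ _ fun x => ?_
    exact CoalgHomClass.counit_comp_apply (B.evalHom f) x
  · refine LinearMap.ext <| CoalgOps.Quot.ind _ _ _ fun x => ?_
    refine Eq.trans ?_ (CoalgHomClass.map_comp_comul_apply (B.evalHom f) x)
    exact (TensorProduct.map_map _ _ _ _ _)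
  · rw [free_str]
    exact B.evalLinear_one f c
  · rw [free_str]
    exact CoalgOps.Quot.ind _ _ _ fun x => CoalgOps.Quot.ind _ _ _ fun y =>
      B.evalLinear_mul f c x y
  · exact B.evalLinear_gen f
  · rintro g ⟨⟨gone, gmul⟩, gunit⟩
    -- Preservation of antipodes is not assumed of `g`, but uniqueness needs it on terms built with
    -- `inv`.
    have ginv := fun c x => HopfStructure.map_antipode _ _ g (gone c) (gmul c) x
    simp only [free_str] at gone gmul ginv
    refine CoalgHom.ext <| CoalgOps.Quot.ind _ _ _ fun x => ?_
    change (g : Free k H c₀ →ₗ[k] W) ((FreeOps.ops k H).proj (FreeOps.genHom k H) c₀ x) =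
      B.evalLinear f x
    suffices (g : Free k H c₀ →ₗ[k] W) ∘ₗ (FreeOps.ops k H).proj (FreeOps.genHom k H) c₀ =
      B.evalLinear f from LinearMap.congr_fun this x
    refine FreeOps.linearMap_ext (fun h => ?_) (fun c => ?_) (fun c x y hx hy => ?_)
      (fun c x hx => ?_)
    · exact (gunit h).trans (B.evalLinear_gen f h).symm
    · exact (gone c).trans (B.evalLinear_one f c).symm
    · refine (gmul c (Submodule.Quotient.mk x) (Submodule.Quotient.mk y)).trans (Eq.trans ?_ (B.evalLinear_mul f c x y).symm)
      exact congrArg₂ (fun a b => (B.str c).mul a b) hx hy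
    · refine (ginv c (Submodule.Quotient.mk x)).trans (Eq.trans ?_ (B.evalLinear_inv f c x).symm)
      exact congrArg (B.str c).antipode hx

end HopfBrace

/-! ### From universal arrows to left adjoints. -/

/-- A universal arrow from `X` is an initial object of the comma category of arrows from `X` to `G`.
-/
theorem CategoryTheory.Functor.isRightAdjoint_of_universal {C D : Type*} [Category C] [Category D]
    (G : D ⥤ C) (h : ∀ X : C, ∃ (Y : D) (η : X ⟶ G.obj Y), ∀ (Y' : D) (f : X ⟶ G.obj Y'),
      ∃! g : Y ⟶ Y', η ≫ G.map g = f) : G.IsRightAdjoint := by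
  have (X : C) : Limits.HasInitial (StructuredArrow X G) := by
    obtain ⟨Y, η, hη⟩ := h X
    refine Limits.IsInitial.hasInitial (X := StructuredArrow.mk η) <|
      Limits.IsInitial.ofUniqueHom
        (fun Z => StructuredArrow.homMk (hη Z.right Z.hom).choose
          (hη Z.right Z.hom).choose_spec.1) fun Z m => ?_
    ext
    exact (hη Z.right Z.hom).choose_spec.2 _ (StructuredArrow.w m)
  exact isRightAdjointOfStructuredArrowInitials G

namespace CocommHopfBraceCat

variable {k : Type u} [Field k]

instance (A : CocommHopfBraceCat k) : IsCocomm k A.obj.carrier := A.property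

instance (H : CocommHopfAlgCat k) : IsCocomm k H.obj := H.property

/-- The free cocommutative Hopf brace on a cocommutative Hopf algebra. -/
noncomputable def free (c₀ : Bool) (H : CocommHopfAlgCat k) : CocommHopfBraceCat k where
  obj := { carrier := HopfBrace.Free k H.obj c₀, brace := HopfBrace.free k H.obj c₀ }
  property := inferInstanceAs (IsCocomm k (HopfBrace.Free k H.obj c₀))

/-- A morphism of cocommutative Hopf braces from a morphism of coalgebras. -/
noncomputable def homOfCoalgHom {A B : CocommHopfBraceCat k}
    (g : A.obj.carrier →ₗc[k] B.obj.carrier)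
    (hone : ∀ c, g (A.obj.brace.str c).one = (B.obj.brace.str c).one)
    (hmul : ∀ c x y, g ((A.obj.brace.str c).mul x y) = (B.obj.brace.str c).mul (g x) (g y)) :
    A ⟶ B :=
  ObjectProperty.homMk (P := HopfBraceCat.isCocomm k)
    (HopfBraceCat.Hom.mk g (hone true) (hmul true) (hone false) (hmul false))

theorem existsUnique_hom {c₀ : Bool} {H : CocommHopfAlgCat k} {B : CocommHopfBraceCat k}
    (f : H.obj →ₗc[k] B.obj.carrier) (hone : f 1 = (B.obj.brace.str c₀).one)
    (hmul : ∀ a b, f (a * b) = (B.obj.brace.str c₀).mul (f a) (f b)) :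
    ∃! g : free c₀ H ⟶ B, ∀ h, g.hom.toCoalgHom (HopfBrace.freeUnit k H.obj c₀ h) = f h := by
  obtain ⟨g, ⟨⟨gone, gmul⟩, gunit⟩, huniq⟩ := B.obj.brace.existsUnique_coalgHom hone hmul
  refine ⟨homOfCoalgHom g gone gmul, gunit, fun g' hg' => ?_⟩
  refine ObjectProperty.hom_ext _ (HopfBraceCat.Hom.ext (huniq _ ⟨⟨?_, ?_⟩, hg'⟩))
  -- The case `false`, the index of the second structure, comes first.
  · rintro (_ | _)
    · exact g'.hom.map_snd_one
    · exact g'.hom.map_fst_one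
  · rintro (_ | _)
    · exact g'.hom.map_snd_mul
    · exact g'.hom.map_fst_mul

theorem exists_universal_fst (H : CocommHopfAlgCat k) :
    ∃ (B : CocommHopfBraceCat k) (η : H ⟶ (forgetFst k).obj B),
      ∀ (B' : CocommHopfBraceCat k) (f : H ⟶ (forgetFst k).obj B'),
        ∃! g : B ⟶ B', η ≫ (forgetFst k).map g = f := by
  refine ⟨free true H, ObjectProperty.homMk (HopfAlgCat.Hom.mk
    { toCoalgHom := HopfBrace.freeUnit k H.obj true
      map_one' := HopfBrace.freeUnit_one
      map_mul' := HopfBrace.freeUnit_mul }), fun B' f => ?_⟩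
  obtain ⟨g, hg, huniq⟩ := existsUnique_hom (c₀ := true) (H := H) (B := B')
    f.hom.toBialgHom.toCoalgHom (map_one f.hom.toBialgHom) (map_mul f.hom.toBialgHom)
  refine ⟨g, ?_, fun g' hg' => huniq g' fun h => ?_⟩
  · exact ObjectProperty.hom_ext _ (HopfAlgCat.hom_ext _ _ (BialgHom.ext hg))
  · exact congr(($hg').hom.toBialgHom h)

theorem exists_universal_snd (H : CocommHopfAlgCat k) :
    ∃ (B : CocommHopfBraceCat k) (η : H ⟶ (forgetSnd k).obj B),
      ∀ (B' : CocommHopfBraceCat k) (f : H ⟶ (forgetSnd k).obj B'),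
        ∃! g : B ⟶ B', η ≫ (forgetSnd k).map g = f := by
  refine ⟨free false H, ObjectProperty.homMk (HopfAlgCat.Hom.mk
    { toCoalgHom := HopfBrace.freeUnit k H.obj false
      map_one' := HopfBrace.freeUnit_one
      map_mul' := HopfBrace.freeUnit_mul }), fun B' f => ?_⟩
  obtain ⟨g, hg, huniq⟩ := existsUnique_hom (c₀ := false) (H := H) (B := B')
    f.hom.toBialgHom.toCoalgHom (map_one f.hom.toBialgHom) (map_mul f.hom.toBialgHom)
  refine ⟨g, ?_, fun g' hg' => huniq g' fun h => ?_⟩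
  · exact ObjectProperty.hom_ext _ (HopfAlgCat.hom_ext _ _ (BialgHom.ext hg))
  · exact congr(($hg').hom.toBialgHom h)

end CocommHopfBraceCat

theorem mainTheorem7 (k : Type u) [Field k] :
    (CocommHopfBraceCat.forgetFst k).IsRightAdjoint ∧
    (CocommHopfBraceCat.forgetSnd k).IsRightAdjoint ∧
    (∀ H : CocommHopfAlgCat k,
      ∃ (B : CocommHopfBraceCat k) (η : H ⟶ (CocommHopfBraceCat.forgetFst k).obj B),
        ∀ (B' : CocommHopfBraceCat k) (f : H ⟶ (CocommHopfBraceCat.forgetFst k).obj B'),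
          ∃! g : B ⟶ B', η ≫ (CocommHopfBraceCat.forgetFst k).map g = f) ∧
    (∀ H : CocommHopfAlgCat k,
      ∃ (B : CocommHopfBraceCat k) (η : H ⟶ (CocommHopfBraceCat.forgetSnd k).obj B),
        ∀ (B' : CocommHopfBraceCat k) (f : H ⟶ (CocommHopfBraceCat.forgetSnd k).obj B'),
          ∃! g : B ⟶ B', η ≫ (CocommHopfBraceCat.forgetSnd k).map g = f) :=
  ⟨Functor.isRightAdjoint_of_universal _ CocommHopfBraceCat.exists_universal_fst,
    Functor.isRightAdjoint_of_universal _ CocommHopfBraceCat.exists_universal_snd,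
    CocommHopfBraceCat.exists_universal_fst, CocommHopfBraceCat.exists_universal_snd⟩
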